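/- Let $\{0,1\}^N$ be the set of binary strings of length $N$. Let $\Gamma$ be the directed graph on $\{0,1\}^N$ in which the direct successors of a string $x$ are the string obtained by replacing the rightmost $0$ of $x$ by $1$ (if $x$ contains a $0$) and the string obtained by replacing the rightmost $1$ of $x$ by $0$ (if $x$ contains a $1$). Let $A_N$ be the $2^N\times 2^N$ adjacency matrix of $\Gamma$, whose entry in row $y$ and column $x$ is $1$ if there is an edge $x\to y$ and $0$ otherwise. Let $U_k$ be the Chebyshev polynomials of the second kind ($U_0=1$, $U_1(\lambda)=2\lambda$, $U_{k+1}=2\lambda U_k-U_{k-1}$), let $S$ be the operation that replaces every $0$ of a string by $1$ and vice versa, write strings next to each other for concatenation, and let $0^j$ and $1^j$ be the strings of $j$ zeros and of $j$ ones. Let $\lambda\in\mathbb{C}$. (a) Let $\ell\ge 0$ with $\ell\le N-2$, and suppose that $U_{\ell+1}(\lambda)=0$ and that $\lambda$ is not a root of $U_1,\dots,U_\ell$. Then for every string $q$ of length $N-\ell-2$ there is exactly one vector $v^{(q)}=(c_w)_{w\in\{0,1\}^N}$ for which $c_w=0$ for every $w$ that does not begin with $q$ and the following relations hold: (i) $c_{q00p}=0$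 for all $p\in\{0,1\}^\ell$; (ii) $c_{q100^{\ell}}=1$; (iii) for every $p\in\{0,1\}^\ell$, written as $p=0^{j_{k+1}}1^{j_k}0^{j_{k-1}}1^{j_{k-2}}\cdots 0^{j_2}1^{j_1}$ with $k$ odd, $j_1,j_{k+1}\ge 0$ and $j_2,\dots,j_k\ge 1$, $$c_{q10p}\prod_{i=1}^{k}U_{s_i}(\lambda)=1,\qquad s_i=j_1+\cdots+j_i;$$ (iv) $c_{q11p}=0$ and $c_{q01p}=-U_\ell(\lambda)\,c_{q10S(p)}$ for all $p\in\{0,1\}^\ell$. The vector $v^{(q)}$ is an eigenvector of $\tfrac12A_N$ with eigenvalue $\lambda$. The vectors $v^{(q)}$, $q\in\{0,1\}^{N-\ell-2}$, form a basis of the eigenspace of $\tfrac12A_N$ for $\lambda$; in particular the geometric multiplicity of $\lambda$ is $2^{N-\ell-2}$. (b) Suppose that $U_{N+1}(\lambda)=0$ and that $\lambda$ is not a root of $U_1,\dots,U_{N-1}$. Then there is exactly one vector $(c_w)_{w\in\{0,1\}^N}$ that satisfies the following relations: (j) $c_{0^N}=1$; (jj) for every $w\in\{0,1\}^N$ of the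 form $w=0^{j_{k+1}}1^{j_k}0^{j_{k-1}}1^{j_{k-2}}\cdots 0^{j_2}1^{j_1}$ with $k$ odd, $j_1\ge 0$ and $j_2,\dots,j_{k+1}\ge 1$, $$c_w\prod_{i=1}^{k}U_{s_i}(\lambda)=1,\qquad s_i=j_1+\cdots+j_i;$$ (jjj) $c_{S(w)}=U_N(\lambda)\,c_w$ for all $w\in\{0,1\}^N$. This vector is an eigenvector of $\tfrac12A_N$ with eigenvalue $\lambda$, and it spans the eigenspace of $\tfrac12A_N$ for $\lambda$. -/

import Mathlib

/-- Binary strings of length `n` (`false` is the digit `0`, `true` is the digit `1`). They are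
the vertices of the graph. -/
abbrev Word (n : ℕ) : Type := List.Vector Bool n

/-- The directed edges `x → y` of the graph on strings: either `y` is obtained from `x` by replacing
the rightmost `0` by `1`, or `y` is obtained from `x` by replacing the rightmost `1` by `0`.
(The all-zero and all-one strings thus have a single direct successor.) -/
def Step (x y : List Bool) : Prop :=
  ∃ (u : List Bool) (m : ℕ),
    (x = u ++ false :: List.replicate m true ∧ y = u ++ true :: List.replicate m true) ∨
    (x = u ++ true :: List.replicate m false ∧ y = u ++ false :: List.replicate m false)

/-- The directed graph on the binary strings of length `N`. -/
def preisachGraph (N : ℕ) : Digraph (Word N) where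
  Adj x y := Step x.toList y.toList

open Classical in
/-- The adjacency matrix `A_N`. The entry in row `y` and column `x` is `1` exactly if there is an
edge `x → y`; with the strings in lexicographic order this is the convention under which `A_0 = (0)`
and `A_{k+1}` has the diagonal blocks `A_k`, `A_k`, the upper right block `diag(1,0,…,0)` and the
lower left block `diag(0,…,0,1)`. -/
noncomputable def adjMat (N : ℕ) : Matrix (Word N) (Word N) ℂ :=
  Matrix.of fun y x => if (preisachGraph N).Adj x y then 1 else 0

/-- The value `U_n(lam)` of the Chebyshev polynomial of the second kind. -/
noncomputable def chebU (n : ℕ) (lam : ℂ) : ℂ := (Polynomial.Chebyshev.U ℂ (n : ℤ)).eval lam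

/-- `v` is an eigenvector of `(1/2) A_N` with eigenvalue `lam` (in particular `v ≠ 0`). -/
def IsEigvec (N : ℕ) (lam : ℂ) (v : Word N → ℂ) : Prop :=
  Module.End.HasEigenvector (Matrix.toLin' ((1 / 2 : ℂ) • adjMat N)) lam v

/-- The eigenspace of `(1/2) A_N` for `lam`. -/
noncomputable def eigSpace (N : ℕ) (lam : ℂ) : Submodule ℂ (Word N → ℂ) :=
  Module.End.eigenspace (Matrix.toLin' ((1 / 2 : ℂ) • adjMat N)) lam

/-- The operation `S`: replace every `0` by `1` and vice versa. -/
def flipWord {n : ℕ} (p : Word n) : Word n := p.map not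

/-- The concatenation `q a b p` of a prefix `q` of length `N - l - 2`, two digits `a`, `b` and a
suffix `p` of length `l`. -/
def blockWord {N l : ℕ} (h : l + 2 ≤ N) (q : Word (N - l - 2)) (a b : Bool) (p : Word l) : Word N :=
  ⟨q.toList ++ a :: b :: p.toList, by simp; omega⟩

/-- The string whose runs are, from right to left, `j 1` ones, `j 2` zeros, `j 3` ones, …,
up to the `m`-th run (odd-numbered runs consist of ones, even-numbered ones of zeros). -/
def runString (j : ℕ → ℕ) : ℕ → List Bool
  | 0 => []
  | m + 1 => List.replicate (j (m + 1)) (decide (Odd (m + 1))) ++ runString j m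

/-- `p = 0^{j_{k+1}} 1^{j_k} 0^{j_{k-1}} ⋯ 0^{j_2} 1^{j_1}` with `j_1, j_{k+1} ≥ 0` and
`j_2, …, j_k ≥ 1`. The leftmost run consists of zeros, so `k` is odd. -/
def IsRunForm (p : List Bool) (k : ℕ) (j : ℕ → ℕ) : Prop :=
  Odd k ∧ (∀ i ∈ Finset.Icc 2 k, 1 ≤ j i) ∧ p = runString j (k + 1)

/-- `∏_{i=1}^k U_{s_i}(lam)` with `s_i = j_1 + ⋯ + j_i`. -/
noncomputable def runProd (lam : ℂ) (k : ℕ) (j : ℕ → ℕ) : ℂ :=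
  ∏ i ∈ Finset.Icc 1 k, chebU (∑ a ∈ Finset.Icc 1 i, j a) lam

/-- The relations that define the vector with the components `c` attached to the prefix `q`. -/
structure BlockRelations {N l : ℕ} (h : l + 2 ≤ N) (lam : ℂ) (q : Word (N - l - 2))
    (c : Word N → ℂ) : Prop where
  /-- the components at strings with another prefix are zero -/
  off : ∀ q' : Word (N - l - 2), q' ≠ q → ∀ (a b : Bool) (p : Word l), c (blockWord h q' a b p) = 0
  /-- `c_{q00p} = 0` -/
  i : ∀ p : Word l, c (blockWord h q false false p) = 0
  /-- `c_{q100^l} = 1` -/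
  ii : c (blockWord h q true false (List.Vector.replicate l false)) = 1
  /-- `c_{q10p} ∏ U_{s_i}(lam) = 1` -/
  iii : ∀ (p : Word l) (k : ℕ) (j : ℕ → ℕ), IsRunForm p.toList k j →
    c (blockWord h q true false p) * runProd lam k j = 1
  /-- `c_{q11p} = 0` and `c_{q01p} = -U_l(lam) c_{q10S(p)}` -/
  iv : ∀ p : Word l, c (blockWord h q true true p) = 0 ∧
    c (blockWord h q false true p) = -chebU l lam * c (blockWord h q true false (flipWord p))

/-- The relations that define the vector with the components `c` in the case `U_{N+1}(lam) = 0`. -/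
structure TopRelations (N : ℕ) (lam : ℂ) (c : Word N → ℂ) : Prop where
  /-- `c_{0^N} = 1` -/
  j : c (List.Vector.replicate N false) = 1
  /-- `c_w ∏ U_{s_i}(lam) = 1` if `w` has the run form with a nonempty leftmost run of zeros -/
  jj : ∀ (w : Word N) (k : ℕ) (j : ℕ → ℕ), IsRunForm w.toList k j → 1 ≤ j (k + 1) →
    c w * runProd lam k j = 1
  /-- `c_{S(w)} = U_N(lam) c_w` -/
  jjj : ∀ w : Word N, c (flipWord w) = chebU N lam * c w

/-! Splitting strings by leading digit makes `A_{k+1}` two copies of `A_k` coupled by only two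
entries, each landing on a constant string. So the equation to carry through the recursion is the
inhomogeneous one, `(2 lam - A_k) c = a e` with `e` the indicator of `b^k` (`IsResponse`). By
`IsResponse.succ_iff` a solution of length `k + 1` is a pair of solutions of length `k`, each driven
by one value of the other.

As long as `U_1, …, U_k` do not vanish at `lam`, the solutions are exactly the multiples of an
explicit function `response`, and the one with value `1` at `b^k` has `a = U_{k+1} / U_k`
(`isResponse_response`, `IsResponse.eq_response`). The induction closes through `U_k U_{k+2} =
U_{k+1}^2 - 1`. Unfolded, `response` picks up a factor `1 / U_s` wherever the digit changes, `s`
being the length of the remaining suffix; this is the product in the relations.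

If `U_{k+1} = 0` then `a = 0`, so the kernel is the line through `response`. With `k = N` this is
(b).

For (a), `U_{l+1} = 0` forces `a = 0` at length `l`. At length `l + 2` the kernel is again a line,
through `blockVec`, whose members vanish on both constant strings, and still only `a = 0` is
solvable. Both properties persist at all greater lengths (`IsResponse.eq_zero_of_le`), so all
further couplings are zero and the eigenspace is a direct sum of such lines, one per prefix `q`. -/

/-! ### Chebyshev identities -/

theorem chebU_zero (lam : ℂ) : chebU 0 lam = 1 := by simp [chebU]

theorem chebU_one (lam : ℂ) : chebU 1 lam = 2 * lam := by simp [chebU]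

theorem chebU_add_two (n : ℕ) (lam : ℂ) :
    chebU (n + 2) lam = 2 * lam * chebU (n + 1) lam - chebU n lam := by
  simp [chebU, Polynomial.Chebyshev.U_add_two]

theorem chebU_mul_chebU_add_two (n : ℕ) (lam : ℂ) :
    chebU n lam * chebU (n + 2) lam = chebU (n + 1) lam ^ 2 - 1 := by
  induction n with
  | zero => rw [chebU_add_two]; simp [chebU_zero, chebU_one]; ring
  | succ n ih =>
    rw [chebU_add_two (n + 1)]
    linear_combination ih - chebU (n + 2) lam * chebU_add_two n lam

/-- At a root of `U_{n+1}` the value `U_n` is a sign; this is why `U_l` and `U_N` can appear as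
symmetry factors, and why they are nonzero. -/
theorem chebU_sq_of_succ_eq_zero {n : ℕ} {lam : ℂ} (h : chebU (n + 1) lam = 0) :
    chebU n lam ^ 2 = 1 := by
  rcases n with _ | n
  · simp [chebU_zero]
  · have := chebU_mul_chebU_add_two n lam
    rw [h] at this
    linear_combination -this

/-! ### Predecessor sums and recursion on the leading digit -/

/-- The sum of the values of `c` over the direct predecessors of a string, by recursion on the
leading digit. -/
def predSum : (List Bool → ℂ) → List Bool → ℂ
  | _, [] => 0
  | c, x :: w => predSum (fun z => c (x :: z)) w +
      if w = List.replicate w.length x then c ((!x) :: w) else 0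

theorem predSum_congr {w : List Bool} : ∀ {c d : List Bool → ℂ},
    (∀ z, z.length = w.length → c z = d z) → predSum c w = predSum d w := by
  induction w with
  | nil => intros; rfl
  | cons x w ih =>
    intro c d h
    simp only [predSum]
    rw [ih (c := fun z => c (x :: z)) (d := fun z => d (x :: z)) (fun z hz => h _ (by simp [hz])),
      h _ (by simp)]

theorem predSum_smul (a : ℂ) (w : List Bool) : ∀ c : List Bool → ℂ,
    predSum (fun z => a * c z) w = a * predSum c w := by
  induction w with
  | nil => intro c; simp [predSum]
  | cons x w ih =>
    intro c
    simp only [predSum]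
    rw [ih (fun z => c (x :: z)), mul_add]
    split_ifs <;> simp

/-- `(2 lam - A_k) c = a e` on strings of length `k`, where `e` is the indicator of the constant
string with digit `b`. -/
def IsResponse (lam : ℂ) (k : ℕ) (c : List Bool → ℂ) (b : Bool) (a : ℂ) : Prop :=
  ∀ w : List Bool, w.length = k →
    2 * lam * c w = predSum c w + if w = List.replicate k b then a else 0

namespace IsResponse

variable {lam : ℂ} {k : ℕ} {c d : List Bool → ℂ} {b : Bool} {a : ℂ}

theorem congr (h : IsResponse lam k c b a) (hcd : ∀ w, w.length = k → c w = d w) :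
    IsResponse lam k d b a := by
  intro w hw
  rw [← hcd w hw, h w hw, predSum_congr (fun z hz => hcd z (hz.trans hw))]

theorem smul (t : ℂ) (h : IsResponse lam k c b a) :
    IsResponse lam k (fun z => t * c z) b (t * a) := by
  intro w hw
  rw [predSum_smul]
  have := h w hw
  split_ifs at this ⊢ <;> linear_combination t * this

theorem zero_iff (b b' : Bool) : IsResponse lam k c b 0 ↔ IsResponse lam k c b' 0 := by
  simp [IsResponse]

theorem zero_fun : IsResponse lam k (fun _ => 0) b 0 := by
  simpa using IsResponse.smul (lam := lam) (k := k) (c := fun _ => 0) (b := b)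
    (a := 0) 0 (by
      have : ∀ w : List Bool, predSum (fun _ => 0) w = 0 := fun w => by
        simpa using predSum_smul 0 w (fun _ => 0)
      intro w _; simp [this])

/-- The only edges that change the leading digit enter `b b^k` from `(!b) b^k` and `(!b) (!b)^k`
from `b (!b)^k`. Each half therefore sees the other as a source at one constant string. -/
theorem succ_iff : IsResponse lam (k + 1) c b a ↔
    IsResponse lam k (fun z => c (b :: z)) b (a + c ((!b) :: List.replicate k b)) ∧
    IsResponse lam k (fun z => c ((!b) :: z)) (!b) (c (b :: List.replicate k (!b))) := by
  constructor
  · intro h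
    refine ⟨fun w hw => ?_, fun w hw => ?_⟩
    · have := h (b :: w) (by simp [hw])
      simp only [predSum, hw, List.replicate_succ, List.cons.injEq, true_and] at this
      rw [this]
      split_ifs with hb
      · subst hb; ring
      · ring
    · have := h ((!b) :: w) (by simp [hw])
      simp only [predSum, hw, List.replicate_succ, List.cons.injEq, Bool.not_not,
        Bool.not_eq_self, false_and, if_false, add_zero] at this
      rw [this]
      split_ifs with hb
      · subst hb; ring
      · ring
  · rintro ⟨h1, h2⟩ w hw
    rcases w with _ | ⟨x, w⟩
    · simp at hw
    · replace hw : w.length = k := by simpa using hw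
      simp only [predSum, hw, List.replicate_succ, List.cons.injEq]
      by_cases hx : x = b
      · subst hx
        rw [h1 w hw]
        split_ifs with h3 h4 h4
        · subst h3; ring
        · simp_all
        · simp_all
        · ring
      · obtain rfl : x = !b := by revert hx; cases x <;> cases b <;> simp
        rw [h2 w hw]
        simp only [Bool.not_not, Bool.not_eq_self, false_and, if_false, add_zero]
        split_ifs with h3
        · subst h3; rfl
        · rfl

end IsResponse

/-! ### Nonvanishing case: the explicit response -/

/-- The response of the graph to the constant string with digit `b`, normalized to be `1` there. -/
noncomputable def response (lam : ℂ) : Bool → List Bool → ℂ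
  | _, [] => 1
  | b, x :: w => response lam x w * if x = b then 1 else (chebU (w.length + 1) lam)⁻¹

theorem response_cons_self (lam : ℂ) (b : Bool) (w : List Bool) :
    response lam b (b :: w) = response lam b w := by simp [response]

theorem response_cons_not (lam : ℂ) (b : Bool) (w : List Bool) :
    response lam b ((!b) :: w) = (chebU (w.length + 1) lam)⁻¹ * response lam (!b) w := by
  simp [response, mul_comm]

theorem response_replicate_append (lam : ℂ) (b : Bool) (n : ℕ) (w : List Bool) :
    response lam b (List.replicate n b ++ w) = response lam b w := by
  induction n with
  | zero => rfl
  | succ n ih => rw [List.replicate_succ, List.cons_append, response_cons_self, ih]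

theorem response_replicate_self (lam : ℂ) (b : Bool) (n : ℕ) :
    response lam b (List.replicate n b) = 1 := by
  simpa [response] using response_replicate_append lam b n []

theorem response_replicate_not (lam : ℂ) (b : Bool) (n : ℕ) :
    response lam b (List.replicate n (!b)) = (chebU n lam)⁻¹ := by
  rcases n with _ | n
  · simp [response, chebU_zero]
  · rw [List.replicate_succ, response_cons_not, response_replicate_self]; simp

theorem response_map_not (lam : ℂ) (b : Bool) (w : List Bool) :
    response lam b (w.map not) = response lam (!b) w := by
  induction w generalizing b with
  | nil => rfl
  | cons x w ih => simp only [List.map_cons, response, ih]; cases x <;> cases b <;> simp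

theorem isResponse_response {lam : ℂ} {k : ℕ} (hU : ∀ i ∈ Finset.Icc 1 k, chebU i lam ≠ 0) :
    ∀ b, IsResponse lam k (response lam b) b (chebU (k + 1) lam / chebU k lam) := by
  induction k with
  | zero =>
    intro b w hw
    obtain rfl : w = [] := by simpa using hw
    simp [response, predSum, chebU_zero, chebU_one]
  | succ k ih =>
    intro b
    have ih := ih (fun i hi => hU i (by simp at hi ⊢; omega))
    have h1 : chebU (k + 1) lam ≠ 0 := hU _ (by simp)
    have h0 : chebU k lam ≠ 0 := by
      rcases k with _ | k
      · simp [chebU_zero]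
      · exact hU _ (by simp)
    rw [IsResponse.succ_iff]
    refine ⟨?_, ?_⟩
    -- The required source is `U_{k+2}/U_{k+1} + 1/(U_{k+1} U_k)`, which equals `U_{k+1}/U_k` by the
    -- product identity.
    · have e : chebU (k + 1 + 1) lam / chebU (k + 1) lam +
          response lam b ((!b) :: List.replicate k b) = chebU (k + 1) lam / chebU k lam := by
        have := response_replicate_not lam (!b) k
        rw [Bool.not_not] at this
        rw [response_cons_not, this, List.length_replicate]
        field_simp
        linear_combination chebU_mul_chebU_add_two k lam
      rw [e]
      simpa only [response_cons_self] using ih b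
    · have e : response lam b (b :: List.replicate k (!b)) =
          (chebU (k + 1) lam)⁻¹ * (chebU (k + 1) lam / chebU k lam) := by
        rw [response_cons_self, response_replicate_not]
        field_simp
      rw [e]
      refine ((ih (!b)).smul (chebU (k + 1) lam)⁻¹).congr fun w hw => ?_
      rw [response_cons_not, hw]

/-- Two equations with the same `c` can be compared at `b^k`, which determines the source. -/
theorem IsResponse.value_eq {lam : ℂ} {k : ℕ} {c : List Bool → ℂ} {b : Bool} {a : ℂ}
    (hU : ∀ i ∈ Finset.Icc 1 k, chebU i lam ≠ 0) (h : IsResponse lam k c b a)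
    (hc : ∀ w, w.length = k → c w = c (List.replicate k b) * response lam b w) :
    a = c (List.replicate k b) * (chebU (k + 1) lam / chebU k lam) := by
  have h2 := ((isResponse_response hU b).smul (c (List.replicate k b))).congr
    (d := c) (fun w hw => (hc w hw).symm)
  have e1 := h (List.replicate k b) (by simp)
  have e2 := h2 (List.replicate k b) (by simp)
  simp only [if_true] at e1 e2
  linear_combination e2 - e1

theorem IsResponse.eq_response {lam : ℂ} {k : ℕ} (hU : ∀ i ∈ Finset.Icc 1 k, chebU i lam ≠ 0) :
    ∀ {c : List Bool → ℂ} {b : Bool} {a : ℂ}, IsResponse lam k c b a →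
    ∀ w, w.length = k → c w = c (List.replicate k b) * response lam b w := by
  induction k with
  | zero =>
    intro c b a _ w hw
    obtain rfl : w = [] := by simpa using hw
    simp [response]
  | succ k ih =>
    intro c b a h
    have hU' : ∀ i ∈ Finset.Icc 1 k, chebU i lam ≠ 0 :=
      fun i hi => hU i (by simp at hi ⊢; omega)
    have h1 : chebU (k + 1) lam ≠ 0 := hU _ (by simp)
    have h0 : chebU k lam ≠ 0 := by
      rcases k with _ | k
      · simp [chebU_zero]
      · exact hU _ (by simp)
    obtain ⟨hf, hg⟩ := IsResponse.succ_iff.1 h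
    have ef := ih hU' hf
    have eg := ih hU' hg
    -- The source driving the `!b` half is a value of the `b` half, so `hv` fixes the ratio of the
    -- two free scalars as `1 / U_{k+1}`.
    have hv := hg.value_eq hU' eg
    rw [ef _ (by simp), response_replicate_not] at hv
    rintro (_ | ⟨x, w⟩) hw
    · simp at hw
    replace hw : w.length = k := by simpa using hw
    by_cases hx : x = b
    · subst hx
      rw [ef w hw, response_cons_self, List.replicate_succ]
    · obtain rfl : x = !b := by revert hx; cases x <;> cases b <;> simp
      rw [eg w hw, response_cons_not, List.replicate_succ, hw]
      field_simp at hv ⊢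
      rw [hv]

theorem isResponse_zero_iff_of_chebU_succ_eq_zero {lam : ℂ} {k : ℕ}
    (hU : ∀ i ∈ Finset.Icc 1 k, chebU i lam ≠ 0) (h0 : chebU (k + 1) lam = 0)
    {c : List Bool → ℂ} {b : Bool} : IsResponse lam k c b 0 ↔
    ∀ w, w.length = k → c w = c (List.replicate k b) * response lam b w := by
  refine ⟨fun h => h.eq_response hU, fun h => ?_⟩
  simpa [h0] using ((isResponse_response hU b).smul (c (List.replicate k b))).congr
    (d := c) (fun w hw => (h w hw).symm)

theorem IsResponse.eq_zero_of_chebU_succ_eq_zero {lam : ℂ} {k : ℕ}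
    (hU : ∀ i ∈ Finset.Icc 1 k, chebU i lam ≠ 0) (h0 : chebU (k + 1) lam = 0)
    {c : List Bool → ℂ} {b : Bool} {a : ℂ} (h : IsResponse lam k c b a) : a = 0 := by
  simpa [h0] using h.value_eq hU (h.eq_response hU)

/-! ### Vanishing of `U_{l+1}`: lengths `l + 1`, `l + 2` and beyond -/

/-- If `U_{l+1}` vanishes, a response of the strings of length `l + 1` to the constant string of
digit `b` lives on the strings with leading digit `!b`. -/
theorem IsResponse.structure_succ {lam : ℂ} {l : ℕ}
    (hU : ∀ i ∈ Finset.Icc 1 l, chebU i lam ≠ 0) (h0 : chebU (l + 1) lam = 0)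
    {c : List Bool → ℂ} {b : Bool} {a : ℂ} (h : IsResponse lam (l + 1) c b a) :
    (∀ w, w.length = l → c (b :: w) = 0) ∧
    (∀ w, w.length = l → c ((!b) :: w) = -(a * chebU l lam) * response lam (!b) w) := by
  have hsq := chebU_sq_of_succ_eq_zero h0
  have hl : chebU l lam ≠ 0 := by rintro e; simp [e] at hsq
  obtain ⟨hf, hg⟩ := IsResponse.succ_iff.1 h
  have ef := hf.eq_response hU
  have eg := hg.eq_response hU
  -- At length `l` no nonzero source is admissible, so both coupling values are determined.
  have a0 := hf.eq_zero_of_chebU_succ_eq_zero hU h0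
  have b0 := hg.eq_zero_of_chebU_succ_eq_zero hU h0
  rw [ef _ (by simp), response_replicate_not] at b0
  have hfb : c (b :: List.replicate l b) = 0 := by simpa [hl] using b0
  have hr := response_replicate_not lam (!b) l
  rw [Bool.not_not] at hr
  rw [eg _ (by simp), hr] at a0
  refine ⟨fun w hw => by rw [ef w hw, hfb, zero_mul], fun w hw => ?_⟩
  rw [eg w hw]
  field_simp at a0
  congr 1
  linear_combination a0

/-- The vector on strings of length `l + 2` spanning the eigenspace in the case `U_{l+1} = 0`. -/
noncomputable def blockVec (lam : ℂ) (l : ℕ) : List Bool → ℂ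
  | true :: false :: p => response lam false p
  | false :: true :: p => -chebU l lam * response lam true p
  | _ => 0

theorem isResponse_blockVec {lam : ℂ} {l : ℕ}
    (hU : ∀ i ∈ Finset.Icc 1 l, chebU i lam ≠ 0) (h0 : chebU (l + 1) lam = 0) :
    IsResponse lam (l + 2) (blockVec lam l) false 0 := by
  have hsq := chebU_sq_of_succ_eq_zero h0
  have hl : chebU l lam ≠ 0 := by rintro e; simp [e] at hsq
  have hr0 := response_replicate_not lam true l
  have hr1 := response_replicate_not lam false l
  have k0 := isResponse_response hU false
  have k1 := (isResponse_response hU true).smul (-chebU l lam)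
  simp only [Bool.not_true, Bool.not_false] at hr0 hr1
  simp only [h0, zero_div, mul_zero] at k0 k1
  rw [IsResponse.succ_iff, IsResponse.succ_iff, IsResponse.succ_iff]
  simp only [List.replicate_succ, Bool.not_false, Bool.not_true, blockVec,
    response_replicate_self, hr0, zero_add, neg_mul, mul_one]
  -- The four quarters have prefixes `00`, `01`, `11`, `10`. On `00` and `11` the incoming source
  -- must cancel: `1 - U_l / U_l` and `-U_l + 1 / U_l`, the latter by `U_l^2 = 1`.
  refine ⟨⟨?_, ?_⟩, ?_, ?_⟩
  · rw [mul_inv_cancel₀ hl]; simpa using IsResponse.zero_fun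
  · simpa using k1
  · rw [hr1, neg_add_eq_zero.2 (by field_simp; exact hsq)]; exact IsResponse.zero_fun
  · exact k0

theorem IsResponse.structure_add_two {lam : ℂ} {l : ℕ}
    (hU : ∀ i ∈ Finset.Icc 1 l, chebU i lam ≠ 0) (h0 : chebU (l + 1) lam = 0)
    {c : List Bool → ℂ} {b : Bool} {a : ℂ} (h : IsResponse lam (l + 2) c b a) :
    a = 0 ∧ ∀ w, w.length = l → c (b :: b :: w) = 0 ∧ c ((!b) :: (!b) :: w) = 0 ∧
      c ((!b) :: b :: w) = c ((!b) :: List.replicate (l + 1) b) * response lam b w ∧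
      c (b :: (!b) :: w) =
        c ((!b) :: List.replicate (l + 1) b) * (-chebU l lam * response lam (!b) w) := by
  have hsq := chebU_sq_of_succ_eq_zero h0
  obtain ⟨hf, hg⟩ := IsResponse.succ_iff.1 h
  obtain ⟨f0, f1⟩ := hf.structure_succ hU h0
  obtain ⟨g0, g1⟩ := hg.structure_succ hU h0
  simp only [Bool.not_not] at g1
  have ef := f1 (List.replicate l (!b)) (by simp)
  have eg := g1 (List.replicate l b) (by simp)
  rw [response_replicate_self, ← List.replicate_succ] at ef eg
  -- Going once around the two halves multiplies the source by `(-U_l)^2 = 1`, leaving no room for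
  -- an additional `a`.
  have ha : a = 0 := by
    linear_combination chebU l lam * ef - eg +
      (-a - c ((!b) :: List.replicate (l + 1) b)) * hsq
  subst ha
  refine ⟨rfl, fun w hw => ⟨f0 w hw, g0 w hw, ?_, ?_⟩⟩
  · rw [g1 w hw]; linear_combination (-response lam b w) * eg
  · rw [f1 w hw]; ring

theorem IsResponse.eq_zero_and_eq_blockVec {lam : ℂ} {l : ℕ}
    (hU : ∀ i ∈ Finset.Icc 1 l, chebU i lam ≠ 0) (h0 : chebU (l + 1) lam = 0)
    {c : List Bool → ℂ} {b : Bool} {a : ℂ} (h : IsResponse lam (l + 2) c b a) :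
    a = 0 ∧ ∀ w, w.length = l + 2 →
      c w = c (true :: List.replicate (l + 1) false) * blockVec lam l w := by
  obtain ⟨rfl, -⟩ := h.structure_add_two hU h0
  obtain ⟨-, hs⟩ := ((IsResponse.zero_iff b false).1 h).structure_add_two hU h0
  refine ⟨rfl, fun w hw => ?_⟩
  obtain ⟨x, y, p, rfl⟩ : ∃ x y p, w = x :: y :: p := by
    rcases w with _ | ⟨x, _ | ⟨y, p⟩⟩ <;> simp at hw ⊢
  obtain ⟨h1, h2, h3, h4⟩ := hs p (by simpa using hw)
  simp only [Bool.not_false] at h1 h2 h3 h4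
  cases x <;> cases y <;> simp only [blockVec, h1, h2, h3, h4, mul_zero]

/-- The two claims need each other: inadmissible sources make both halves kernel elements, and
kernel elements vanish at constant strings, so the coupling drops out and `a` itself must be zero.
-/
theorem IsResponse.eq_zero_of_le {lam : ℂ} {l : ℕ}
    (hU : ∀ i ∈ Finset.Icc 1 l, chebU i lam ≠ 0) (h0 : chebU (l + 1) lam = 0) (m : ℕ) :
    (∀ (c : List Bool → ℂ) (b : Bool) (a : ℂ), IsResponse lam (m + (l + 2)) c b a → a = 0) ∧
    ∀ (c : List Bool → ℂ) (b : Bool), IsResponse lam (m + (l + 2)) c b 0 →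
      c (List.replicate (m + (l + 2)) b) = 0 := by
  induction m with
  | zero =>
    rw [zero_add]
    refine ⟨fun c b a h => (h.eq_zero_and_eq_blockVec hU h0).1, fun c b h => ?_⟩
    exact ((h.structure_add_two hU h0).2 (List.replicate l b) (by simp)).1
  | succ m ih =>
    obtain ⟨ih1, ih2⟩ := ih
    rw [Nat.add_right_comm]
    refine ⟨fun c b a h => ?_, fun c b h => ?_⟩
    · obtain ⟨hf, hg⟩ := IsResponse.succ_iff.1 h
      have e1 := ih1 _ _ _ hf
      have e2 := ih1 _ _ _ hg
      rw [e2] at hg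
      have e3 := ih2 _ _ ((IsResponse.zero_iff _ b).1 hg)
      simpa [e3] using e1
    · obtain ⟨hf, -⟩ := IsResponse.succ_iff.1 h
      rw [ih1 _ _ _ hf] at hf
      exact ih2 _ _ hf

/-- The eigenspace decomposes along the prefixes. -/
theorem isResponse_zero_iff_forall_prefix {lam : ℂ} {l : ℕ}
    (hU : ∀ i ∈ Finset.Icc 1 l, chebU i lam ≠ 0) (h0 : chebU (l + 1) lam = 0) (m : ℕ) :
    ∀ (c : List Bool → ℂ) (b : Bool), IsResponse lam (m + (l + 2)) c b 0 ↔
      ∀ q : List Bool, q.length = m →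
        ∀ w, w.length = l + 2 →
          c (q ++ w) = c (q ++ true :: List.replicate (l + 1) false) * blockVec lam l w := by
  induction m with
  | zero =>
    intro c b
    simp only [List.length_eq_zero_iff, zero_add, forall_eq, List.nil_append]
    refine ⟨fun h => (h.eq_zero_and_eq_blockVec hU h0).2, fun h => ?_⟩
    rw [IsResponse.zero_iff b false]
    simpa using ((isResponse_blockVec hU h0).smul _).congr (fun w hw => (h w hw).symm)
  | succ m ih =>
    intro c b
    have hz := IsResponse.eq_zero_of_le hU h0 m
    rw [Nat.add_right_comm, IsResponse.succ_iff]
    have key : (∀ x : Bool, IsResponse lam (m + (l + 2)) (fun z => c (x :: z)) b 0) ↔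
        ∀ q : List Bool, q.length = m + 1 → ∀ w, w.length = l + 2 →
          c (q ++ w) = c (q ++ true :: List.replicate (l + 1) false) * blockVec lam l w := by
      simp only [ih]
      refine ⟨fun h q hq w hw => ?_, fun h x q hq w hw => h (x :: q) (by simp [hq]) w hw⟩
      rcases q with _ | ⟨x, q⟩
      · simp at hq
      · exact h x q (by simpa using hq) w hw
    rw [← key]
    constructor
    · rintro ⟨hf, hg⟩ x
      rw [hz.1 _ _ _ hf] at hf
      rw [hz.1 _ _ _ hg] at hg
      by_cases hx : x = b
      · exact hx ▸ hf
      · obtain rfl : x = !b := by revert hx; cases x <;> cases b <;> simp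
        exact (IsResponse.zero_iff _ _).1 hg
    · intro h
      have hg := (IsResponse.zero_iff b (!b)).1 (h (!b))
      -- Conversely, the couplings vanish because kernel elements are zero at constant strings, so
      -- the halves may be chosen independently.
      rw [zero_add, hz.2 _ _ (h (!b)), hz.2 _ _ ((IsResponse.zero_iff b (!b)).1 (h b))]
      exact ⟨h b, hg⟩

/-! ### Run decompositions and the product formula -/

theorem length_runString (j : ℕ → ℕ) (m : ℕ) :
    (runString j m).length = ∑ a ∈ Finset.Icc 1 m, j a := by
  induction m with
  | zero => simp [runString]
  | succ m ih => rw [runString, Finset.sum_Icc_succ_top (by omega)]; simp [ih, add_comm]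

theorem runString_congr {i j : ℕ → ℕ} {m : ℕ} (h : ∀ a ∈ Finset.Icc 1 m, i a = j a) :
    runString i m = runString j m := by
  induction m with
  | zero => rfl
  | succ m ih =>
    rw [runString, runString, h (m + 1) (by simp),
      ih (fun a ha => h a (by simp at ha ⊢; omega))]

/-- Only the first letter of a run differing from the current digit costs a factor, `1 / U_s` with
`s` the length of the suffix starting there, which is the partial sum `s_i`. -/
theorem response_runString_mul_prod {lam : ℂ} {j : ℕ → ℕ} (m : ℕ)
    (hj : ∀ i ∈ Finset.Icc 2 m, 1 ≤ j i)
    (hU : ∀ i ∈ Finset.Icc 1 (∑ a ∈ Finset.Icc 1 m, j a), chebU i lam ≠ 0) :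
    response lam (decide (Odd (m + 1))) (runString j (m + 1)) * runProd lam m j = 1 := by
  induction m with
  | zero => simp [runString, runProd, response_replicate_self]
  | succ m ih =>
    have hsum := Finset.sum_Icc_succ_top (show 1 ≤ m + 1 by omega) j
    have ih := ih (fun i hi => hj i (by simp at hi ⊢; omega))
      (fun i hi => hU i (by simp at hi ⊢; omega))
    have hodd : decide (Odd (m + 1 + 1)) = !decide (Odd (m + 1)) := by
      rw [← decide_not]; exact decide_eq_decide.2 Nat.odd_add_one
    rw [runString, response_replicate_append, hodd, runProd,
      Finset.prod_Icc_succ_top (by omega)]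
    change _ * (runProd lam m j * _) = 1
    rw [← length_runString]
    rw [← length_runString] at hU
    -- Only the rightmost run may be empty; its factor is then `U_0 = 1`.
    rcases Nat.eq_zero_or_pos (j (m + 1)) with h0 | hpos
    · have hm : m = 0 := by
        by_contra hm
        have := hj (m + 1) (by simp; omega)
        omega
      subst hm
      simp [runString, runProd, h0, response, chebU_zero]
    · obtain ⟨n, hn⟩ := Nat.exists_eq_add_of_lt hpos
      rw [zero_add] at hn
      have hlen : chebU (runString j (m + 1)).length lam ≠ 0 :=
        hU _ (by simp [runString, hn]; omega)
      rw [runString, hn, List.replicate_succ, List.cons_append] at ih hlen ⊢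
      generalize decide (Odd (m + 1)) = b at *
      have hc := response_cons_not lam (!b) (List.replicate n b ++ runString j m)
      rw [Bool.not_not] at hc
      rw [hc, List.length_cons]
      rw [response_cons_self] at ih
      rw [List.length_cons] at hlen
      field_simp
      exact ih

theorem response_mul_runProd {lam : ℂ} {p : List Bool} {k : ℕ} {j : ℕ → ℕ}
    (h : IsRunForm p k j)
    (hU : ∀ i ∈ Finset.Icc 1 (∑ a ∈ Finset.Icc 1 k, j a), chebU i lam ≠ 0) :
    response lam false p * runProd lam k j = 1 := by
  obtain ⟨hk, hj, rfl⟩ := h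
  have := response_runString_mul_prod k hj hU
  rwa [show decide (Odd (k + 1)) = false by simpa [Nat.odd_add_one] using hk] at this

theorem IsRunForm.length_eq {p : List Bool} {k : ℕ} {j : ℕ → ℕ} (h : IsRunForm p k j) :
    p.length = (∑ a ∈ Finset.Icc 1 k, j a) + j (k + 1) := by
  rw [h.2.2, length_runString, Finset.sum_Icc_succ_top (by omega)]

theorem exists_isRunForm (p : List Bool) : ∃ k j, IsRunForm p k j := by
  induction p with
  | nil => exact ⟨1, fun _ => 0, by simp, by simp, by simp [runString]⟩
  | cons x p ih =>
    obtain ⟨k, j, hk, hj, rfl⟩ := ih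
    have he : decide (Odd (k + 1)) = false := by simpa [Nat.odd_add_one] using hk
    have ho : decide (Odd k) = true := by simpa using hk
    cases x
    · refine ⟨k, Function.update j (k + 1) (j (k + 1) + 1), hk, fun i hi => ?_, ?_⟩
      · rw [Function.update_of_ne (by simp at hi; omega)]; exact hj i hi
      · rw [runString, runString, runString_congr (i := Function.update j _ _) (j := j)
          (fun a ha => Function.update_of_ne (by simp at ha; omega) _ _), Function.update_self, he,
          List.replicate_succ, List.cons_append]
    · obtain ⟨n, rfl⟩ : ∃ n, k = n + 1 := ⟨k - 1, by have := hk.pos; omega⟩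
      -- A new leading `1` lengthens the last run of ones if the leftmost run of zeros is empty.
      -- Otherwise it opens a run of length `1`, followed by an empty run of zeros to keep `k` odd.
      by_cases h0 : j (n + 1 + 1) = 0
      · refine ⟨n + 1, Function.update j (n + 1) (j (n + 1) + 1), hk, fun i hi => ?_, ?_⟩
        · by_cases hin : i = n + 1
          · subst hin; simp
          · rw [Function.update_of_ne hin]; exact hj i hi
        · rw [runString, runString, runString, runString,
            runString_congr (i := Function.update j _ _) (j := j)
            (fun a ha => Function.update_of_ne (by simp at ha; omega) _ _), Function.update_self,
            Function.update_of_ne (by omega), h0, ho]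
          simp [List.replicate_succ]
      · refine ⟨n + 3, Function.update (Function.update j (n + 3) 1) (n + 4) 0, ?_,
          fun i hi => ?_, ?_⟩
        · have := hk.add_even (show Even 2 by decide)
          exact this
        · rw [Function.update_of_ne (by simp at hi; omega)]
          by_cases hin : i = n + 3
          · subst hin; simp
          · rw [Function.update_of_ne hin]
            simp at hi
            by_cases hin2 : i = n + 2
            · subst hin2; exact Nat.one_le_iff_ne_zero.2 h0
            · exact hj i (by simp; omega)
        · have ho' : decide (Odd (n + 3)) = true := by
            simpa using hk.add_even (show Even 2 by decide)
          set f := Function.update (Function.update j (n + 3) 1) (n + 4) 0 with hf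
          have e1 : f (n + 4) = 0 := by simp [hf]
          have e2 : f (n + 3) = 1 := by simp [hf]
          have e3 : runString f (n + 1 + 1) = runString j (n + 1 + 1) := by
            refine runString_congr fun a ha => ?_
            rw [hf, Function.update_of_ne (by simp at ha; omega),
              Function.update_of_ne (by simp at ha; omega)]
          change _ = List.replicate (f (n + 4)) _ ++
            (List.replicate (f (n + 3)) (decide (Odd (n + 3))) ++ runString f (n + 1 + 1))
          rw [e1, e2, e3, ho']
          rfl

theorem IsRunForm.one_le_of_head_false {p : List Bool} {k : ℕ} {j : ℕ → ℕ}
    (h : IsRunForm (false :: p) k j) : 1 ≤ j (k + 1) := by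
  by_contra h0
  obtain ⟨hk, hj, he⟩ := h
  obtain ⟨n, rfl⟩ : ∃ n, k = n + 1 := ⟨k - 1, by have := hk.pos; omega⟩
  rw [runString, runString, show j (n + 1 + 1) = 0 by omega, show decide (Odd (n + 1)) = true by simpa using hk] at he
  rcases hm : j (n + 1) with _ | m
  · obtain rfl : n = 0 := by
      by_contra hn
      have := hj (n + 1) (by simp; omega)
      omega
    rw [hm] at he
    simp [runString] at he
  · rw [hm] at he
    simp [List.replicate_succ] at he

/-! ### From the graph and its matrix to predecessor sums -/

theorem step_cons_cons {a b : Bool} {x y : List Bool} (hxy : x.length = y.length) :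
    Step (a :: x) (b :: y) ↔
      (a = b ∧ Step x y) ∨ (a = !b ∧ x = y ∧ y = List.replicate y.length b) := by
  constructor
  · rintro ⟨_ | ⟨d, u⟩, m, h | h⟩
    · obtain ⟨h1, h2⟩ := h
      simp only [List.nil_append, List.cons.injEq] at h1 h2
      obtain ⟨rfl, rfl⟩ := h1
      obtain ⟨rfl, rfl⟩ := h2
      right; simp
    · obtain ⟨h1, h2⟩ := h
      simp only [List.nil_append, List.cons.injEq] at h1 h2
      obtain ⟨rfl, rfl⟩ := h1
      obtain ⟨rfl, rfl⟩ := h2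
      right; simp
    · obtain ⟨h1, h2⟩ := h
      simp only [List.cons_append, List.cons.injEq] at h1 h2
      exact .inl ⟨h1.1.trans h2.1.symm, u, m, .inl ⟨h1.2, h2.2⟩⟩
    · obtain ⟨h1, h2⟩ := h
      simp only [List.cons_append, List.cons.injEq] at h1 h2
      exact .inl ⟨h1.1.trans h2.1.symm, u, m, .inr ⟨h1.2, h2.2⟩⟩
  · rintro (⟨rfl, u, m, h | h⟩ | ⟨rfl, rfl, h⟩)
    · exact ⟨a :: u, m, .inl (by simp [h.1, h.2])⟩
    · exact ⟨a :: u, m, .inr (by simp [h.1, h.2])⟩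
    · refine ⟨[], x.length, ?_⟩
      cases b
      · right; simpa using h
      · left; simpa using h

theorem not_step_nil (x : List Bool) : ¬ Step x [] := by
  rintro ⟨u, m, h | h⟩ <;> simp at h

theorem sum_word_succ {n : ℕ} (F : Word (n + 1) → ℂ) :
    ∑ x, F x = ∑ w : Word n, F (true ::ᵥ w) + ∑ w : Word n, F (false ::ᵥ w) := by
  let e : Bool × Word n ≃ Word (n + 1) :=
    { toFun := fun z => z.1 ::ᵥ z.2
      invFun := fun w => (w.head, w.tail)
      left_inv := fun z => by simp
      right_inv := fun w => by simp }
  rw [← e.sum_comp, Fintype.sum_prod_type, Fintype.sum_bool]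
  rfl

open Classical in
theorem sum_step_eq_predSum (N : ℕ) : ∀ (c : List Bool → ℂ) (y : List Bool), y.length = N →
    ∑ x : Word N, (if Step x.toList y then c x.toList else 0) = predSum c y := by
  induction N with
  | zero =>
    intro c y hy
    obtain rfl : y = [] := by simpa using hy
    simp [not_step_nil, predSum]
  | succ N ih =>
    intro c y hy
    rcases y with _ | ⟨b, y⟩
    · simp at hy
    obtain ⟨y, rfl⟩ : ∃ w : Word N, y = w.toList := ⟨⟨y, by simpa using hy⟩, rfl⟩
    have hS : ∀ (a : Bool) (x : Word N), Step (a :: x.toList) (b :: y.toList) ↔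
        (a = b ∧ Step x.toList y.toList) ∨ (a = !b ∧ x = y ∧ y.toList = List.replicate N b) := by
      intro a x
      rw [step_cons_cons (by simp), List.Vector.toList_length]
      exact or_congr Iff.rfl
        (and_congr Iff.rfl (and_congr List.Vector.toList_injective.eq_iff Iff.rfl))
    have hsame : ∑ x : Word N,
        (if Step (b :: x.toList) (b :: y.toList) then c (b :: x.toList) else 0) =
        predSum (fun z => c (b :: z)) y.toList := by
      rw [← ih _ y.toList (by simp)]
      simp [hS]
    have hdiff : ∑ x : Word N,
        (if Step ((!b) :: x.toList) (b :: y.toList) then c ((!b) :: x.toList) else 0) =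
        if y.toList = List.replicate N b then c ((!b) :: y.toList) else 0 := by
      rw [Finset.sum_eq_single y]
      · simp [hS]
      · intro x _ hx; simp [hS, hx]
      · simp
    rw [sum_word_succ, predSum, List.Vector.toList_length, ← hsame, ← hdiff]
    simp only [List.Vector.toList_cons]
    cases b
    · rw [add_comm]; rfl
    · rfl

/-- The function on lists that agrees with `c` on the strings of length `N` and vanishes on all
other lists. -/
noncomputable def extendWord {N : ℕ} (c : Word N → ℂ) (w : List Bool) : ℂ :=
  if h : w.length = N then c ⟨w, h⟩ else 0

theorem extendWord_toList {N : ℕ} (c : Word N → ℂ) (w : Word N) :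
    extendWord c w.toList = c w :=
  dif_pos w.2

theorem exists_word_of_length_eq {N : ℕ} {w : List Bool} (h : w.length = N) :
    ∃ v : Word N, v.toList = w :=
  ⟨⟨w, h⟩, rfl⟩

theorem adjMat_mulVec {N : ℕ} (c : Word N → ℂ) (w : Word N) :
    (adjMat N).mulVec c w = predSum (extendWord c) w.toList := by
  rw [← sum_step_eq_predSum N _ _ (by simp)]
  refine Finset.sum_congr rfl fun x _ => ?_
  change adjMat N w x * c x = _
  by_cases hs : Step x.toList w.toList
  · have : adjMat N w x = 1 := if_pos hs
    rw [this, if_pos hs, one_mul, extendWord_toList]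
  · have : adjMat N w x = 0 := if_neg hs
    rw [this, if_neg hs, zero_mul]

/-- With source `0` the digit is immaterial; `false` is an arbitrary choice. -/
theorem mem_eigSpace_iff {N : ℕ} {lam : ℂ} {c : Word N → ℂ} :
    c ∈ eigSpace N lam ↔ IsResponse lam N (extendWord c) false 0 := by
  have hA : ∀ w : Word N, Matrix.toLin' ((1 / 2 : ℂ) • adjMat N) c w =
      1 / 2 * predSum (extendWord c) w.toList := by
    intro w
    rw [Matrix.toLin'_apply, Matrix.smul_mulVec, Pi.smul_apply, adjMat_mulVec, smul_eq_mul]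
  rw [eigSpace, Module.End.mem_eigenspace_iff, funext_iff]
  simp only [hA, Pi.smul_apply, smul_eq_mul]
  constructor
  · intro h w hw
    obtain ⟨w, rfl⟩ := exists_word_of_length_eq hw
    rw [extendWord_toList, ite_self]
    linear_combination -2 * h w
  · intro h w
    have := h w.toList (by simp)
    rw [extendWord_toList, ite_self] at this
    linear_combination (-1 / 2) * this

theorem word_eq_of_toList {n : ℕ} {v w : Word n} (h : v.toList = w.toList) : v = w :=
  List.Vector.toList_injective h

theorem eq_of_mul_eq_one {a b x : ℂ} (ha : a * x = 1) (hb : b * x = 1) : a = b := by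
  have hx : x ≠ 0 := by rintro rfl; simp at ha
  exact mul_right_cancel₀ hx (ha.trans hb.symm)

/-! ### The case `U_{N+1} = 0` -/

section Top

variable {N : ℕ} {lam : ℂ}

theorem chebU_ne_zero_of_top (h0 : chebU (N + 1) lam = 0)
    (hU : ∀ i ∈ Finset.Icc 1 (N - 1), chebU i lam ≠ 0) :
    ∀ i ∈ Finset.Icc 1 N, chebU i lam ≠ 0 := by
  intro i hi
  by_cases hN : i = N
  · subst hN
    rintro e
    simpa [e] using chebU_sq_of_succ_eq_zero h0
  · exact hU i (by simp at hi ⊢; omega)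

theorem TopRelations.unique {c d : Word N → ℂ} (hc : TopRelations N lam c)
    (hd : TopRelations N lam d) : c = d := by
  have key : ∀ w : Word N, w.toList.head? ≠ some true → c w = d w := by
    intro w hw
    rcases hl : w.toList with _ | ⟨x, p⟩
    -- The empty string has no run form with a nonempty leftmost run, so here `N = 0` and relation
    -- `j` is needed.
    · have : w = List.Vector.replicate N false := by
        apply word_eq_of_toList
        have hN : N = 0 := by simpa [hl] using w.toList_length.symm
        subst hN
        simp
      rw [this, hc.j, hd.j]
    · obtain ⟨k, j, hk⟩ := exists_isRunForm w.toList
      obtain rfl : x = false := by simpa [hl] using hw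
      have h1 := IsRunForm.one_le_of_head_false (hl ▸ hk)
      exact eq_of_mul_eq_one (hc.jj w k j hk h1) (hd.jj w k j hk h1)
  funext w
  by_cases hw : w.toList.head? = some true
  · have h2 : (flipWord w).toList.head? ≠ some true := by
      rw [flipWord, List.Vector.toList_map, List.head?_map, hw]; simp
    have hww : flipWord (flipWord w) = w := by
      apply word_eq_of_toList
      simp [flipWord, List.Vector.toList_map]
    rw [← hww, hc.jjj, hd.jjj, key _ h2]
  · exact key w hw

theorem topRelations_response (h0 : chebU (N + 1) lam = 0)
    (hU : ∀ i ∈ Finset.Icc 1 N, chebU i lam ≠ 0) :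
    TopRelations N lam (fun w => response lam false w.toList) where
  j := response_replicate_self lam false N
  jj w k j hk _ := by
    refine response_mul_runProd hk fun i hi => hU i ?_
    have := hk.length_eq
    simp at hi this ⊢
    omega
  jjj w := by
    have hsq := chebU_sq_of_succ_eq_zero h0
    simp only [flipWord, List.Vector.toList_map]
    have hlen := w.toList_length
    rw [response_map_not]
    rcases hl : w.toList with _ | ⟨x, p⟩
    · have hN : N = 0 := by simpa [hl] using hlen.symm
      subst hN
      simp [response, chebU_zero]
    · rw [hl, List.length_cons] at hlen
      -- Exchanging the reference digit moves the factor `1 / U_N` of the first letter from one side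
      -- to the other; `U_N` is its own inverse.
      have hinv : (chebU N lam)⁻¹ = chebU N lam :=
        inv_eq_of_mul_eq_one_left (by rw [← sq, hsq])
      cases x <;> simp [response, hlen, hinv, mul_comm]
      rw [← mul_assoc, ← sq, hsq, one_mul]

end Top

/-! ### The case `U_{l+1} = 0`: one eigenvector per prefix -/

section Block

variable {N l : ℕ} {lam : ℂ}

/-- The eigenvector attached to the prefix `q`. -/
noncomputable def prefixVec (lam : ℂ) (l : ℕ) {m N : ℕ} (q : Word m) (w : Word N) : ℂ :=
  if w.toList.take m = q.toList then blockVec lam l (w.toList.drop m) else 0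

theorem prefixVec_of_toList_eq {m : ℕ} (q q' : Word m) {w : Word N} {p : List Bool}
    (hw : w.toList = q'.toList ++ p) :
    prefixVec lam l q w = if q' = q then blockVec lam l p else 0 := by
  have h1 : w.toList.take m = q'.toList := by
    rw [hw, List.take_left' (by simp)]
  have h2 : w.toList.drop m = p := by
    rw [hw, List.drop_left' (by simp)]
  rw [prefixVec, h1, h2]
  exact if_congr List.Vector.toList_injective.eq_iff rfl rfl

theorem prefixVec_blockWord (h : l + 2 ≤ N) (q q' : Word (N - l - 2)) (a b : Bool) (p : Word l) :
    prefixVec lam l q (blockWord h q' a b p) =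
      if q' = q then blockVec lam l (a :: b :: p.toList) else 0 :=
  prefixVec_of_toList_eq q q' rfl

theorem exists_eq_blockWord (h : l + 2 ≤ N) (w : Word N) :
    ∃ q a b p, w = blockWord h q a b p := by
  have hlen := w.toList_length
  have hd : (w.toList.drop (N - l - 2)).length = l + 2 := by simp; omega
  rcases he : w.toList.drop (N - l - 2) with _ | ⟨a, _ | ⟨b, p⟩⟩
  · simp [he] at hd
  · simp [he] at hd
  · refine ⟨⟨w.toList.take (N - l - 2), by simp; omega⟩, a, b, ⟨p, by simpa [he] using hd⟩, ?_⟩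
    apply word_eq_of_toList
    change w.toList = w.toList.take (N - l - 2) ++ a :: b :: p
    rw [← he, List.take_append_drop]

theorem BlockRelations.unique {h : l + 2 ≤ N} {q : Word (N - l - 2)} {c d : Word N → ℂ}
    (hc : BlockRelations h lam q c) (hd : BlockRelations h lam q d) : c = d := by
  have key : ∀ p : Word l, c (blockWord h q true false p) = d (blockWord h q true false p) := by
    intro p
    obtain ⟨k, j, hk⟩ := exists_isRunForm p.toList
    exact eq_of_mul_eq_one (hc.iii p k j hk) (hd.iii p k j hk)
  funext w
  obtain ⟨q', a, b, p, rfl⟩ := exists_eq_blockWord h w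
  by_cases hq : q' = q
  · subst hq
    cases a <;> cases b
    · rw [hc.i, hd.i]
    · rw [(hc.iv p).2, (hd.iv p).2, key]
    · exact key p
    · rw [(hc.iv p).1, (hd.iv p).1]
  · rw [hc.off q' hq, hd.off q' hq]

theorem blockRelations_prefixVec (h : l + 2 ≤ N) (hU : ∀ i ∈ Finset.Icc 1 l, chebU i lam ≠ 0)
    (q : Word (N - l - 2)) : BlockRelations h lam q (prefixVec lam l q) where
  off q' hq a b p := by rw [prefixVec_blockWord, if_neg hq]
  i p := by simp [prefixVec_blockWord, blockVec]
  ii := by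
    rw [prefixVec_blockWord, if_pos rfl]
    exact response_replicate_self lam false l
  iii p k j hk := by
    rw [prefixVec_blockWord, if_pos rfl]
    refine response_mul_runProd hk fun i hi => hU i ?_
    have := hk.length_eq
    simp at hi this ⊢
    omega
  iv p := by
    refine ⟨by simp [prefixVec_blockWord, blockVec], ?_⟩
    simp only [prefixVec_blockWord, if_true, blockVec]
    rw [flipWord, List.Vector.toList_map, response_map_not, Bool.not_false]

/-- The string `q 1 0 0^l`, at which the eigenvector attached to `q` is normalized. -/
def pivotWord (h : l + 2 ≤ N) (q : Word (N - l - 2)) : Word N :=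
  blockWord h q true false (List.Vector.replicate l false)

/-- Evaluation at the pivot strings is dual to the family, giving both linear independence and the
coordinates of an eigenvector. -/
theorem prefixVec_pivotWord (h : l + 2 ≤ N) (q q' : Word (N - l - 2)) :
    prefixVec lam l q (pivotWord h q') = if q' = q then 1 else 0 := by
  rw [pivotWord, prefixVec_blockWord]
  exact if_congr Iff.rfl (response_replicate_self lam false l) rfl

theorem mem_eigSpace_iff_forall_block (h : l + 2 ≤ N) (h0 : chebU (l + 1) lam = 0)
    (hU : ∀ i ∈ Finset.Icc 1 l, chebU i lam ≠ 0) {c : Word N → ℂ} :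
    c ∈ eigSpace N lam ↔ ∀ (q : Word (N - l - 2)) (a b : Bool) (p : Word l),
      c (blockWord h q a b p) = c (pivotWord h q) * blockVec lam l (a :: b :: p.toList) := by
  have hN : N = (N - l - 2) + (l + 2) := by omega
  have hpre := isResponse_zero_iff_forall_prefix hU h0 (N - l - 2) (extendWord c) false
  rw [← hN] at hpre
  rw [mem_eigSpace_iff, hpre]
  constructor
  · intro H q a b p
    have := H q.toList (by simp) (a :: b :: p.toList) (by simp)
    rwa [← extendWord_toList c, ← extendWord_toList c (pivotWord h q)]
  · intro H q hq w hw
    rcases w with _ | ⟨a, _ | ⟨b, p⟩⟩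
    · simp at hw
    · simp at hw
    · obtain ⟨q, rfl⟩ := exists_word_of_length_eq hq
      obtain ⟨p, rfl⟩ := exists_word_of_length_eq (show p.length = l by simpa using hw)
      have := H q a b p
      rwa [← extendWord_toList c, ← extendWord_toList c (pivotWord h _)] at this

theorem prefixVec_mem_eigSpace (h : l + 2 ≤ N) (h0 : chebU (l + 1) lam = 0)
    (hU : ∀ i ∈ Finset.Icc 1 l, chebU i lam ≠ 0) (q : Word (N - l - 2)) :
    prefixVec lam l q ∈ eigSpace N lam := by
  rw [mem_eigSpace_iff_forall_block h h0 hU]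
  intro q' a b p
  rw [prefixVec_blockWord, prefixVec_pivotWord]
  split_ifs <;> simp

theorem linearIndependent_prefixVec (h : l + 2 ≤ N) :
    LinearIndependent ℂ (fun q : Word (N - l - 2) => (prefixVec lam l q : Word N → ℂ)) := by
  rw [Fintype.linearIndependent_iff]
  intro g hg q
  simpa [prefixVec_pivotWord] using congrFun hg (pivotWord h q)

theorem span_prefixVec (h : l + 2 ≤ N) (h0 : chebU (l + 1) lam = 0)
    (hU : ∀ i ∈ Finset.Icc 1 l, chebU i lam ≠ 0) :
    Submodule.span ℂ (Set.range fun q : Word (N - l - 2) => (prefixVec lam l q : Word N → ℂ)) =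
      eigSpace N lam := by
  apply le_antisymm
  · rw [Submodule.span_le]
    rintro _ ⟨q, rfl⟩
    exact prefixVec_mem_eigSpace h h0 hU q
  · intro c hc
    rw [mem_eigSpace_iff_forall_block h h0 hU] at hc
    have : c = ∑ q : Word (N - l - 2), c (pivotWord h q) • (prefixVec lam l q : Word N → ℂ) := by
      funext w
      obtain ⟨q, a, b, p, rfl⟩ := exists_eq_blockWord h w
      simp [hc, prefixVec_blockWord]
    rw [this]
    exact Submodule.sum_mem _ fun q _ => Submodule.smul_mem _ _ (Submodule.subset_span ⟨q, rfl⟩)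

end Block

/-! ### Both cases assembled -/

theorem theorem4 (N : ℕ) (lam : ℂ) :
    (∀ (l : ℕ) (h : l + 2 ≤ N), chebU (l + 1) lam = 0 →
      (∀ i ∈ Finset.Icc 1 l, chebU i lam ≠ 0) →
      ∃ v : Word (N - l - 2) → Word N → ℂ,
        (∀ (q : Word (N - l - 2)) (c : Word N → ℂ), BlockRelations h lam q c ↔ c = v q) ∧
        (∀ q : Word (N - l - 2), IsEigvec N lam (v q)) ∧
        LinearIndependent ℂ v ∧
        Submodule.span ℂ (Set.range v) = eigSpace N lam ∧
        Module.finrank ℂ (eigSpace N lam) = 2 ^ (N - l - 2)) ∧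
    (chebU (N + 1) lam = 0 →
      (∀ i ∈ Finset.Icc 1 (N - 1), chebU i lam ≠ 0) →
      ∃ v : Word N → ℂ,
        (∀ c : Word N → ℂ, TopRelations N lam c ↔ c = v) ∧
        IsEigvec N lam v ∧
        Submodule.span ℂ {v} = eigSpace N lam ∧
        Module.finrank ℂ (eigSpace N lam) = 1) := by
  refine ⟨fun l h h0 hU => ?_, fun h0 hU => ?_⟩
  · have hli := linearIndependent_prefixVec (lam := lam) h
    have hsp := span_prefixVec h h0 hU
    refine ⟨fun q => prefixVec lam l q, fun q c => ⟨fun hc => ?_, ?_⟩, fun q => ?_, hli, hsp, ?_⟩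
    · exact hc.unique (blockRelations_prefixVec h hU q)
    · rintro rfl; exact blockRelations_prefixVec h hU q
    · exact ⟨prefixVec_mem_eigSpace h h0 hU q, hli.ne_zero q⟩
    · rw [← hsp, finrank_span_eq_card hli, card_vector, Fintype.card_bool]
  · replace hU := chebU_ne_zero_of_top h0 hU
    have hrel := topRelations_response h0 hU
    set v : Word N → ℂ := fun w => response lam false w.toList with hv
    have hmem : ∀ c : Word N → ℂ, c ∈ eigSpace N lam ↔
        ∀ w, c w = c (List.Vector.replicate N false) * v w := by
      intro c
      have hrep : extendWord c (List.replicate N false) = c (List.Vector.replicate N false) :=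
        extendWord_toList c (List.Vector.replicate N false)
      rw [mem_eigSpace_iff, isResponse_zero_iff_of_chebU_succ_eq_zero hU h0, hrep]
      refine ⟨fun H w => ?_, fun H w hw => ?_⟩
      · rw [← H w.toList (by simp), extendWord_toList]
      · exact (extendWord_toList c ⟨w, hw⟩).trans (H ⟨w, hw⟩)
    have hvmem : v ∈ eigSpace N lam := by
      rw [hmem, hrel.j]; simp
    have hv0 : v ≠ 0 := by
      intro e
      have := hrel.j
      simp [e] at this
    have hsp : Submodule.span ℂ {v} = eigSpace N lam := by
      apply le_antisymm
      · rwa [Submodule.span_singleton_le_iff_mem]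
      · intro c hc
        rw [Submodule.mem_span_singleton]
        exact ⟨_, funext fun w => ((hmem c).1 hc w).symm⟩
    refine ⟨v, fun c => ⟨fun hc => hc.unique hrel, fun e => e ▸ hrel⟩, ⟨hvmem, hv0⟩, hsp, ?_⟩
    rw [← hsp, finrank_span_singleton hv0]
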